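/- **Definitions.** For a linear code $C\subseteq\mathbb F_q^n$ and $S\subseteq[n]=\{1,\dots,n\}$, let $C_S$ be the projection of $C$ to the coordinates in $S$, and let $d(\cdot)$ denote the minimum Hamming distance between distinct codewords ($\infty$ for a code with only one word). For integers $1\le r\le k$ and $\delta\ge 2$, an $(r,\delta)$-locality set of $C$ is a set $S\subseteq[n]$ with $|S|\le r+\delta-1$ and $d(C_S)\ge\delta$. A linear LRC with parameters $(n,k,r,\delta)$ is a $k$-dimensional linear code $C\subseteq\mathbb F_q^n$ over some finite field $\mathbb F_q$ (of any size) such that every $l\in[n]$ lies in an $(r,\delta)$-locality set of $C$. Let $d_{\max}(n,k,r,\delta)$ be the largest minimum distance $d(C)$ of a linear LRC $C$ with parameters $(n,k,r,\delta)$. **Theorem.** Let $n,k,r,\delta$ be integers, and put $$a=r\left\lceil \frac kr\right\rceil-k,\qquad b=(r+\delta-1)\left\lceil\frac n{r+\delta-1}\right\rceil-n .$$ Suppose that $0<r<k\le n-\lceil k/r\rceil(\delta-1)$, $\delta\ge2$, $\lceil k/r\rceil=2$, $b>a\ge\lceil k/r\rceil-1$, and $$\left\lceil\frac n{r+\delta-1}\right\rceil\ge\left\lceil\frac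 ba\right\rceil+1 .$$ Then the maximum $d_{\max}(n,k,r,\delta)$ exists and $$d_{\max}(n,k,r,\delta)=n-k+1-\left(\left\lceil\frac kr\right\rceil-1\right)(\delta-1).$$ That is, no linear LRC with parameters $(n,k,r,\delta)$ has a larger minimum distance, and some such code over some finite field attains this value (the generalized Singleton bound). -/

import Mathlib

open Classical in
/-- Minimum Hamming distance of a code: the least Hamming distance between two distinct codewords.
It takes values in `ℕ∞`, so a code with at most one codeword has minimum distance `⊤`. -/
noncomputable def minDist {ι F : Type*} [Fintype ι] (C : Set (ι → F)) : ℕ∞ :=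
  ⨅ x ∈ C, ⨅ y ∈ C, ⨅ _ : x ≠ y, (hammingDist x y : ℕ∞)

/-- The projection `C_S` of a linear code `C` to the coordinates in `S`. -/
def projCode {F : Type*} [Field F] {n : ℕ} (C : Submodule F (Fin n → F)) (S : Finset (Fin n)) :
    Submodule F (S → F) :=
  C.map (LinearMap.funLeft F F (Subtype.val : S → Fin n))

/-- `S` is an `(r, δ)`-locality set of the linear code `C`. -/
def IsLocalitySet {F : Type*} [Field F] {n : ℕ} (C : Submodule F (Fin n → F)) (r δ : ℕ)
    (S : Finset (Fin n)) : Prop :=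
  S.card ≤ r + δ - 1 ∧ (δ : ℕ∞) ≤ minDist (projCode C S : Set (S → F))

/-- `C` has all-symbol locality `(r, δ)`: every coordinate lies in an `(r, δ)`-locality set. -/
def HasAllSymbolLocality {F : Type*} [Field F] {n : ℕ} (C : Submodule F (Fin n → F))
    (r δ : ℕ) : Prop :=
  ∀ l : Fin n, ∃ S : Finset (Fin n), l ∈ S ∧ IsLocalitySet C r δ S

/-- The minimum distances of linear LRCs with parameters `(n, k, r, δ)`, over all finite fields:
the `d` for which some linear code of length `n` and dimension `k` over some finite field has
all-symbol locality `(r, δ)` and minimum distance `d`. -/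
def achievableDistances (n k r δ : ℕ) : Set ℕ :=
  {d | ∃ (F : Type) (_ : Field F) (_ : Finite F) (C : Submodule F (Fin n → F)),
    Module.finrank F C = k ∧ HasAllSymbolLocality C r δ ∧
      minDist (C : Set (Fin n → F)) = (d : ℕ∞)}

/-- `d` is `d_max(n, k, r, δ)`: the largest minimum distance of a linear LRC with parameters
`(n, k, r, δ)`; in particular it is attained by such a code. -/
def IsDMax (n k r δ d : ℕ) : Prop :=
  IsGreatest (achievableDistances n k r δ) d

/-! Upper bound: a locality set S meeting the support of C has dim C_S ≤ |S| - (δ - 1) ≤ r < k by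
the Singleton bound. So the words vanishing on S form a nonzero subcode, and Singleton applied to it
gives d ≤ n - k + 1 - (δ - 1).

Attainment: put L = r + δ - 1 and m + 1 = ⌈n/L⌉. Take a generic parity-check matrix with δ - 1 rows
supported on each of m + 1 local sets, and dense rows up to n - k in total. A word in its kernel is
zero once its support can be matched injectively to rows whose supports contain it
(`exists_generic_matrix`). By Hall's theorem this holds below the desired weight if any p ≥ 2 local
sets cover at least k + p(δ - 1) points. `exists_covering` ensures this, as k = 2r - a, by letting
each later set meet the first in at most a points. The total overlap b fits because b ≤ m a, which
is the hypothesis ⌈n/L⌉ ≥ ⌈b/a⌉ + 1. -/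

/-! ### Singleton-type upper bounds -/

theorem le_minDist_iff {ι F : Type*} [Fintype ι] [DecidableEq F] [Field F] (C : Submodule F (ι → F))
    (d : ℕ∞) : d ≤ minDist (C : Set (ι → F)) ↔ ∀ x ∈ C, x ≠ 0 → d ≤ (hammingNorm x : ℕ∞) := by
  unfold minDist
  simp only [le_iInf_iff]
  constructor
  · intro h x hx hx0
    have := h x hx 0 C.zero_mem hx0
    rw [← hammingDist_zero_right]
    refine this.trans_eq ?_
    congr!
  · intro h x hx y hy hxy
    have := h (x - y) (C.sub_mem hx hy) (sub_ne_zero.mpr hxy)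
    rw [sub_eq_neg_add, ← hammingDist_eq_hammingNorm, hammingDist_comm] at this
    refine this.trans_eq ?_
    congr!

/-- The Singleton bound for a code all of whose words vanish on `S`. -/
theorem exists_hammingNorm_add_finrank_add_card_le {ι F : Type*} [Fintype ι] [DecidableEq F]
    [Field F] (C : Submodule F (ι → F)) (hC : C ≠ ⊥) (S : Finset ι)
    (hS : ∀ x ∈ C, ∀ i ∈ S, x i = 0) :
    ∃ x ∈ C, x ≠ 0 ∧ hammingNorm x + Module.finrank F C + S.card ≤ Fintype.card ι + 1 := by
  classical
  have hpos : 0 < Module.finrank F C := Submodule.one_le_finrank_iff.2 hC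
  -- If the minimum were |Sᶜ|, the word found below would vanish everywhere; so T has dim C - 1
  -- elements.
  obtain ⟨T, hTS, hT⟩ := Finset.exists_subset_card_eq
    (min_le_right (Module.finrank F C - 1) Sᶜ.card)
  let f : C →ₗ[F] (T → F) := (LinearMap.funLeft F F (Subtype.val : T → ι)).comp C.subtype
  have hlt : Module.finrank F (T → F) < Module.finrank F C := by
    simp only [Module.finrank_fintype_fun_eq_card, Fintype.card_coe]
    omega
  obtain ⟨⟨x, hxC⟩, hxk, hx0⟩ :=
    (Submodule.ne_bot_iff _).1 (LinearMap.ker_ne_bot_of_finrank_lt hlt (f := f))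
  have hx0' : x ≠ 0 := fun h => hx0 (Subtype.ext h)
  have hxT : ∀ i ∈ T, x i = 0 := fun i hi => congrFun (LinearMap.mem_ker.1 hxk) ⟨i, hi⟩
  refine ⟨x, hxC, hx0', ?_⟩
  have hdisj : Disjoint S T := Finset.disjoint_right.2 fun i hi => Finset.mem_compl.1 (hTS hi)
  have hsub : ({i | x i ≠ 0} : Finset ι) ⊆ (S ∪ T)ᶜ := by
    intro i hi
    simp only [Finset.mem_filter, Finset.mem_univ, true_and] at hi
    simp only [Finset.mem_compl, Finset.mem_union, not_or]
    exact ⟨fun h => hi (hS x hxC i h), fun h => hi (hxT i h)⟩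
  have hcard := Finset.card_le_card hsub
  have hpos' := hammingNorm_pos_iff.2 hx0'
  have hnorm : hammingNorm x = ({i | x i ≠ 0} : Finset ι).card := rfl
  have hle := Finset.card_le_univ (S ∪ T)
  rw [Finset.card_compl, Finset.card_union_of_disjoint hdisj] at hcard
  rw [Finset.card_union_of_disjoint hdisj] at hle
  rw [Finset.card_compl] at hT
  omega

/-- The generalized Singleton bound for `r < k`, with one locality set taken into account. -/
theorem minDist_add_le_of_hasAllSymbolLocality {F : Type*} [Field F] {n : ℕ}
    (C : Submodule F (Fin n → F)) {r δ d : ℕ} (hδ : 1 ≤ δ) (hr : r < Module.finrank F C)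
    (hC : HasAllSymbolLocality C r δ) (hd : (d : ℕ∞) ≤ minDist (C : Set (Fin n → F))) :
    d + Module.finrank F C + δ ≤ n + 2 := by
  classical
  have hCbot : C ≠ ⊥ := Submodule.one_le_finrank_iff.1 (by omega)
  obtain ⟨x, hxC, hx0⟩ := (Submodule.ne_bot_iff _).1 hCbot
  -- Choosing l in the support makes C_S nonzero; for a zero projection, d(C_S) = ∞ says nothing
  -- about |S|.
  obtain ⟨l, hl⟩ := Function.ne_iff.1 hx0
  obtain ⟨S, hlS, hSr, hSδ⟩ := hC l
  have hP : projCode C S ≠ ⊥ := by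
    refine (Submodule.ne_bot_iff _).2 ⟨_, Submodule.mem_map_of_mem hxC, fun h => hl ?_⟩
    exact congrFun h ⟨l, hlS⟩
  obtain ⟨y, hyP, hy0, hy⟩ := exists_hammingNorm_add_finrank_add_card_le _ hP ∅ (by simp)
  have hyδ := (le_minDist_iff _ _).1 hSδ y hyP hy0
  rw [Nat.cast_le] at hyδ
  simp only [Finset.card_empty, Fintype.card_coe] at hy
  let f : C →ₗ[F] (S → F) := (LinearMap.funLeft F F (Subtype.val : S → Fin n)).comp C.subtype
  have hrange : LinearMap.range f = projCode C S := by
    simp [f, projCode, LinearMap.range_comp]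
  have hrn := LinearMap.finrank_range_add_finrank_ker f
  rw [hrange] at hrn
  let D : Submodule F (Fin n → F) := (LinearMap.ker f).map C.subtype
  have hDfin : Module.finrank F D = Module.finrank F (LinearMap.ker f) :=
    (Submodule.equivMapOfInjective _ C.injective_subtype _).finrank_eq.symm
  have hDbot : D ≠ ⊥ := Submodule.one_le_finrank_iff.1 (by omega)
  obtain ⟨z, hzD, hz0, hz⟩ := exists_hammingNorm_add_finrank_add_card_le D hDbot S (by
    rintro _ ⟨w, hw, rfl⟩ i hi
    exact congrFun (LinearMap.mem_ker.1 hw) ⟨i, hi⟩)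
  have hzC : z ∈ C := by
    obtain ⟨w, -, rfl⟩ := hzD
    exact w.2
  have hzd := (le_minDist_iff _ _).1 hd z hzC hz0
  rw [Nat.cast_le] at hzd
  simp only [Fintype.card_fin] at hz
  omega

/-! ### Generic matrices with prescribed support -/

/-- A generic matrix with prescribed support over a large prime field: every square submatrix
whose diagonal lies in the support is nonsingular. -/
theorem exists_generic_matrix {R N : Type} [Fintype R] [Fintype N] [DecidableEq R] [DecidableEq N]
    (s : R → N → Prop) :
    ∃ (p : ℕ) (_ : Fact p.Prime) (H : Matrix R N (ZMod p)),
      (∀ i j, ¬ s i j → H i j = 0) ∧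
      ∀ (E : Finset N) (f : E → R), Function.Injective f → (∀ e, s (f e) e) →
        (H.submatrix f Subtype.val).det ≠ 0 := by
  classical
  let M : Matrix R N (MvPolynomial (R × N) ℤ) :=
    Matrix.of fun i j => if s i j then MvPolynomial.X (i, j) else 0
  let P : (Σ E : Finset N, E → R) → MvPolynomial (R × N) ℤ := fun q =>
    (M.submatrix q.2 Subtype.val).det
  let I : Finset (Σ E : Finset N, E → R) :=
    {q | Function.Injective q.2 ∧ ∀ e, s (q.2 e) e}
  have hP : ∀ q ∈ I, P q ≠ 0 := by
    rintro ⟨E, f⟩ hq h0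
    obtain ⟨hinj, hs⟩ := (Finset.mem_filter.1 hq).2
    -- Specializing to the indicator of the graph of f turns the minor into the identity.
    let φ : MvPolynomial (R × N) ℤ →+* ℤ :=
      MvPolynomial.eval fun ij => if ∃ e : E, f e = ij.1 ∧ e.1 = ij.2 then 1 else 0
    have h1 : φ (P ⟨E, f⟩) = 1 := by
      have : φ.mapMatrix (M.submatrix f Subtype.val) = (1 : Matrix E E ℤ) := by
        ext e e'
        by_cases hee : e = e'
        · subst hee
          have he : s (f e) e := hs e
          have : ∃ a : E, f a = f e ∧ a.1 = e.1 := ⟨e, rfl, rfl⟩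
          simp only [RingHom.mapMatrix_apply, Matrix.map_apply, Matrix.submatrix_apply, M, φ,
            Matrix.of_apply, if_pos he, MvPolynomial.eval_X, if_pos this, Matrix.one_apply_eq]
        · have : ¬ ∃ a : E, f a = f e ∧ a.1 = e'.1 := by
            rintro ⟨a, ha, ha'⟩
            exact hee ((hinj ha).symm.trans (Subtype.ext ha'))
          by_cases hse : s (f e) e'
          · simp only [RingHom.mapMatrix_apply, Matrix.map_apply, Matrix.submatrix_apply, M, φ,
              Matrix.of_apply, if_pos hse, MvPolynomial.eval_X, if_neg this, Matrix.one_apply_ne hee]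
          · simp [M, hse, Matrix.one_apply_ne hee]
      change φ (Matrix.det _) = 1
      rw [RingHom.map_det, this, Matrix.det_one]
    rw [h0, map_zero] at h1
    exact zero_ne_one h1
  have hprod : ∏ q ∈ I, P q ≠ 0 := Finset.prod_ne_zero_iff.2 hP
  obtain ⟨x, hx⟩ : ∃ x : R × N → ℤ, MvPolynomial.eval x (∏ q ∈ I, P q) ≠ 0 := by
    by_contra! h
    exact hprod (MvPolynomial.funext fun x => by simpa using h x)
  -- A prime exceeding the nonzero integer value of the product cannot divide it, so all minors
  -- survive mod p.
  obtain ⟨p, hple, hp⟩ :=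
    Nat.exists_infinite_primes ((MvPolynomial.eval x (∏ q ∈ I, P q)).natAbs + 1)
  let ψ : MvPolynomial (R × N) ℤ →+* ZMod p := (Int.castRingHom (ZMod p)).comp (MvPolynomial.eval x)
  have hψ : ψ (∏ q ∈ I, P q) ≠ 0 := by
    intro h
    have hdvd := (ZMod.intCast_zmod_eq_zero_iff_dvd _ p).1
      (show ((MvPolynomial.eval x (∏ q ∈ I, P q) : ℤ) : ZMod p) = 0 from h)
    have := Nat.le_of_dvd (Int.natAbs_pos.2 hx) (Int.natCast_dvd.1 hdvd)
    omega
  have : Fact p.Prime := ⟨hp⟩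
  refine ⟨p, ⟨hp⟩, M.map ψ, ?_, ?_⟩

  · intro i j hij
    simp [M, hij]
  · intro E f hinj hs
    rw [map_prod] at hψ
    have := Finset.prod_ne_zero_iff.1 hψ ⟨E, f⟩ (Finset.mem_filter.2 ⟨Finset.mem_univ _, hinj, hs⟩)
    simp only [P, RingHom.map_det] at this
    exact this

/-- A vector in the kernel of the rows picked out by a nonsingular square submatrix, with no
contribution to these rows from outside, vanishes on the columns of the submatrix. -/
theorem eq_zero_of_det_submatrix_ne_zero {R N F : Type*} [Fintype N] [DecidableEq N] [Field F]
    (H : Matrix R N F) (v : N → F) (E : Finset N) (f : E → R)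
    (hdet : (H.submatrix f Subtype.val).det ≠ 0) (hv : ∀ e, (H.mulVec v) (f e) = 0)
    (hout : ∀ e, ∀ j ∉ E, H (f e) j * v j = 0) : ∀ j ∈ E, v j = 0 := by
  have h : (H.submatrix f Subtype.val).mulVec (fun e : E => v e) = 0 := by
    ext e
    rw [Pi.zero_apply, ← hv e]
    simp only [Matrix.mulVec, dotProduct, Matrix.submatrix_apply]
    rw [Finset.sum_coe_sort E (fun j => H (f e) j * v j)]
    exact Finset.sum_subset (Finset.subset_univ E) fun j _ hj => hout e j hj
  have h0 := Matrix.eq_zero_of_mulVec_eq_zero hdet h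
  exact fun j hj => congrFun h0 ⟨j, hj⟩

/-! ### Coverings with controlled overlap -/

theorem sum_range_min_sub_min (a b m : ℕ) :
    ∑ i ∈ Finset.range (m + 1), (min b (i * a) - min b ((i - 1) * a)) = min b (m * a) := by
  induction m with
  | zero => simp
  | succ m ih =>
    rw [Finset.sum_range_succ, ih, Nat.add_sub_cancel]
    have : m * a ≤ (m + 1) * a := Nat.mul_le_mul_right _ (Nat.le_succ m)
    omega

/-- A covering of `n` points by `m + 1` sets of size at most `L`, which overlap only in subsets of
size at most `a` of the first one. -/
theorem exists_covering (n m a b L : ℕ) (hn : n + b = (m + 1) * L) (hb : b ≤ m * a) (haL : a ≤ L) :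
    ∃ S : Fin (m + 1) → Finset (Fin n), (∀ i, (S i).card ≤ L) ∧ (∀ l, ∃ i, l ∈ S i) ∧
      ∀ P : Finset (Fin (m + 1)), P.Nonempty → L + (P.card - 1) * (L - a) ≤ (P.biUnion S).card := by
  classical
  -- Greedy splitting of the overlap b into parts of size at most a; truncated subtraction gives x 0
  -- = 0, so the first set is a full block.
  let x : ℕ → ℕ := fun i => min b (i * a) - min b ((i - 1) * a)
  have hxa : ∀ i, x i ≤ a := by
    intro i
    simp only [x]
    cases i with
    | zero => simp
    | succ i =>
      rw [Nat.add_sub_cancel, Nat.succ_mul]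
      omega
  have hx0 : x 0 = 0 := by simp [x]
  have hxsum : ∑ i : Fin (m + 1), x i = b := by
    rw [Fin.sum_univ_eq_sum_range x, sum_range_min_sub_min, min_eq_left hb]
  let Q := Σ i : Fin (m + 1), Fin (L - x i)
  have hcard : Fintype.card Q = n := by
    have h1 : ∑ i : Fin (m + 1), (L - x i) + ∑ i : Fin (m + 1), x i = (m + 1) * L := by
      rw [← Finset.sum_add_distrib]
      simp [fun i => Nat.sub_add_cancel ((hxa i).trans haL)]
    simp only [Q, Fintype.card_sigma, Fintype.card_fin]
    omega
  let e : Q ≃ Fin n := Fintype.equivFinOfCardEq hcard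
  let Y : Fin (m + 1) → Finset Q := fun i => Finset.univ.map (Function.Embedding.sigmaMk i)
  have hYcard : ∀ i, (Y i).card = L - x i := fun i => by simp [Y]
  have hY : ∀ i q, q ∈ Y i ↔ q.1 = i := by
    rintro i ⟨j, t⟩
    simp only [Y, Finset.mem_map, Finset.mem_univ, true_and]
    constructor
    · rintro ⟨t, h⟩
      exact (congrArg Sigma.fst h).symm
    · rintro rfl
      exact ⟨t, rfl⟩
  -- Block Y i is padded to size L by x i points borrowed from block 0.
  let X : Fin (m + 1) → Finset Q := fun i =>
    Finset.univ.map ((Fin.castLEEmb (show x i ≤ L - x (0 : Fin (m + 1)) by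
      simpa [hx0] using (hxa i).trans haL)).trans
        (Function.Embedding.sigmaMk (β := fun i : Fin (m + 1) => Fin (L - x i)) 0))
  have hXcard : ∀ i, (X i).card = x i := fun i => by simp [X]
  have hX : ∀ i, ∀ q ∈ X i, q.1 = 0 := by
    intro i q hq
    obtain ⟨t, -, rfl⟩ := Finset.mem_map.1 hq
    rfl
  have hXY : ∀ i, Disjoint (X i) (Y i) := by
    intro i
    rcases eq_or_ne i 0 with rfl | hi
    · have : X 0 = ∅ := Finset.card_eq_zero.1 (by rw [hXcard]; exact hx0)
      simp [this]
    · refine Finset.disjoint_left.2 fun q hq hq' => hi ?_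
      rw [← (hY i q).1 hq', hX i q hq]
  have hXYcard : ∀ i, (X i ∪ Y i).card = L := by
    intro i
    rw [Finset.card_union_of_disjoint (hXY i), hXcard, hYcard]
    have := (hxa i).trans haL
    omega
  refine ⟨fun i => (X i ∪ Y i).map e.toEmbedding, fun i => ?_, fun l => ?_, fun P hP => ?_⟩
  · rw [Finset.card_map, hXYcard]
  · refine ⟨(e.symm l).1, Finset.mem_map.2 ⟨e.symm l, ?_, by simp⟩⟩
    exact Finset.mem_union_right _ ((hY _ _).2 rfl)
  -- The least set is counted in full, the others only by their blocks. These have index above i ≥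
  -- 0, so they avoid X i, which lies in block 0.
  · let i := P.min' hP
    have hlt : ∀ j ∈ P.erase i, i < j := fun j hj =>
      lt_of_le_of_ne (P.min'_le j (Finset.mem_of_mem_erase hj)) (Finset.ne_of_mem_erase hj).symm
    have hdisj : Disjoint (X i ∪ Y i) ((P.erase i).biUnion Y) := by
      refine Finset.disjoint_left.2 fun q hq hq' => ?_
      obtain ⟨j, hj, hqj⟩ := Finset.mem_biUnion.1 hq'
      have hij := hlt j hj
      rw [hY] at hqj
      rcases Finset.mem_union.1 hq with h | h
      · rw [← hqj, hX i q h] at hij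
        exact absurd hij (Fin.not_lt_zero _)
      · rw [hY] at h
        exact hij.ne (h.symm.trans hqj)
    have hsub : (X i ∪ Y i ∪ (P.erase i).biUnion Y).map e.toEmbedding ⊆
        P.biUnion fun i => (X i ∪ Y i).map e.toEmbedding := by
      intro y hy
      obtain ⟨q, hq, rfl⟩ := Finset.mem_map.1 hy
      rw [Finset.mem_biUnion]
      rcases Finset.mem_union.1 hq with h | h
      · exact ⟨i, P.min'_mem hP, Finset.mem_map_of_mem _ h⟩
      · obtain ⟨j, hj, hqj⟩ := Finset.mem_biUnion.1 h
        exact ⟨j, Finset.mem_of_mem_erase hj,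
          Finset.mem_map_of_mem _ (Finset.mem_union_right _ hqj)⟩
    refine le_trans ?_ (Finset.card_le_card hsub)
    rw [Finset.card_map, Finset.card_union_of_disjoint hdisj, hXYcard, Finset.card_biUnion]
    · rw [← Finset.card_erase_of_mem (P.min'_mem hP), ← smul_eq_mul]
      refine Nat.add_le_add_left (Finset.card_nsmul_le_sum _ _ _ fun j _ => ?_) _
      rw [hYcard]
      exact Nat.sub_le_sub_left (hxa j) L
    · intro j _ j' _ hjj
      refine Finset.disjoint_left.2 fun q hq hq' => hjj ?_
      rw [← (hY j q).1 hq, (hY j' q).1 hq']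

/-! ### Codes from generic parity checks -/

/-- If the unions of the local sets are large, a generic parity-check matrix with `δ - 1` checks on
each of them and dense checks otherwise gives an optimal code. -/
theorem exists_code_of_covering {n k r δ m : ℕ} (hm : 2 ≤ m) (hδ : 1 ≤ δ)
    (S : Fin m → Finset (Fin n)) (hSr : ∀ i, (S i).card ≤ r + δ - 1) (hcov : ∀ l, ∃ i, l ∈ S i)
    (hS : ∀ P : Finset (Fin m), 2 ≤ P.card → k + P.card * (δ - 1) ≤ (P.biUnion S).card) :
    ∃ (F : Type) (_ : Field F) (_ : Finite F) (C : Submodule F (Fin n → F)),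
      Module.finrank F C = k ∧ HasAllSymbolLocality C r δ ∧
        ((n + 2 - k - δ : ℕ) : ℕ∞) ≤ minDist (C : Set (Fin n → F)) := by
  classical
  have hn : k + m * (δ - 1) ≤ n := by
    have h1 := hS Finset.univ (by simpa using hm)
    have h2 := Finset.card_le_univ (Finset.univ.biUnion S)
    simp only [Finset.card_univ, Fintype.card_fin] at h1 h2
    omega
  obtain ⟨g, hg⟩ := Nat.exists_eq_add_of_le hn
  let R := (Fin m × Fin (δ - 1)) ⊕ Fin g
  let s : R → Fin n → Prop := Sum.elim (fun i j => j ∈ S i.1) fun _ _ => True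
  obtain ⟨p, hp, H, hH, hdet⟩ := exists_generic_matrix s
  have hker : k ≤ Module.finrank (ZMod p) (LinearMap.ker H.mulVecLin) := by
    have h1 := LinearMap.finrank_range_add_finrank_ker H.mulVecLin
    have h2 := Submodule.finrank_le (LinearMap.range H.mulVecLin)
    simp only [Module.finrank_fintype_fun_eq_card, Fintype.card_fin, R, Fintype.card_sum,
      Fintype.card_prod] at h1 h2
    omega
  -- Passing to a subspace of the kernel fixes the dimension and keeps every parity check.
  obtain ⟨C, hCker, hCk⟩ : ∃ C : Submodule (ZMod p) (Fin n → ZMod p),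
      C ≤ LinearMap.ker H.mulVecLin ∧ Module.finrank (ZMod p) C = k := by
    obtain ⟨v, hv⟩ := exists_linearIndependent_of_le_finrank hker
    have hv' := hv.map' (LinearMap.ker H.mulVecLin).subtype (Submodule.ker_subtype _)
    refine ⟨Submodule.span (ZMod p) (Set.range (Subtype.val ∘ v)), Submodule.span_le.2 ?_, ?_⟩
    · rintro _ ⟨i, rfl⟩
      exact (v i).2
    · exact (finrank_span_eq_card hv').trans (Fintype.card_fin k)
  have hCH : ∀ v ∈ C, ∀ i, (H.mulVec v) i = 0 := fun v hv i =>
    congrFun (LinearMap.mem_ker.1 (hCker hv)) i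
  refine ⟨ZMod p, inferInstance, inferInstance, C, hCk, fun l => ?_, ?_⟩
  · obtain ⟨i, hi⟩ := hcov l
    refine ⟨S i, hi, hSr i, (le_minDist_iff _ _).2 ?_⟩
    rintro _ ⟨v, hv, rfl⟩ hv0
    rw [Nat.cast_le]
    by_contra! hlt
    let E : Finset (Fin n) := {j ∈ S i | v j ≠ 0}
    have hE : E.card ≤ δ - 1 := by
      have : hammingNorm (LinearMap.funLeft (ZMod p) (ZMod p) (Subtype.val : S i → Fin n) v)
          = E.card := by
        rw [hammingNorm, ← Finset.card_map (Function.Embedding.subtype _)]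
        congr 1
        ext j
        simp only [E, Finset.mem_map, Finset.mem_filter, Finset.mem_univ, true_and]
        constructor
        · rintro ⟨a, ha, rfl⟩
          exact ⟨a.2, ha⟩
        · rintro ⟨hj, hvj⟩
          exact ⟨⟨j, hj⟩, hvj, rfl⟩
      omega
    let ι : E ↪ Fin (δ - 1) := (Function.Embedding.nonempty_of_card_le (by simpa using hE)).some
    have hzero := eq_zero_of_det_submatrix_ne_zero H v E (fun e => Sum.inl (i, ι e))
      (hdet E _ (fun e e' h => ι.injective (Prod.mk.inj (Sum.inl.inj h)).2)
        fun e => (Finset.mem_filter.1 e.2).1)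
      (fun e => hCH v hv _) (fun e j hj => by
        by_cases hjS : j ∈ S i
        · have : v j = 0 := by
            by_contra hvj
            exact hj (Finset.mem_filter.2 ⟨hjS, hvj⟩)
          rw [this, mul_zero]
        · rw [hH _ _ (show ¬ s (Sum.inl (i, ι e)) j from hjS), zero_mul])
    refine hv0 (funext fun j => ?_)
    by_contra hj
    exact hj (hzero j (Finset.mem_filter.2 ⟨j.2, hj⟩))
  · refine (le_minDist_iff _ _).2 fun v hv hv0 => ?_
    rw [Nat.cast_le]
    by_contra! hlt
    let E : Finset (Fin n) := {j | v j ≠ 0}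
    have hE : E.card + k + (δ - 1) ≤ n := by
      have : hammingNorm v = E.card := rfl
      omega
    obtain ⟨f, hf, hfs⟩ : ∃ f : E → R, Function.Injective f ∧
        ∀ e : E, f e ∈ (Finset.univ.filter fun i => s i e) := by
      refine (Finset.all_card_le_biUnion_card_iff_exists_injective
        fun e : E => Finset.univ.filter fun i => s i e).1 fun A => ?_
      rcases A.eq_empty_or_nonempty with rfl | ⟨e₀, he₀⟩
      · simp
      let A' : Finset (Fin n) := A.map (Function.Embedding.subtype _)
      have hA' : A'.card = A.card := Finset.card_map _
      have hAE : A.card ≤ E.card := by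
        simpa using Finset.card_le_univ A
      -- Q indexes the local sets meeting A; A is adjacent to all their checks and to all g dense
      -- ones.
      let Q : Finset (Fin m) := {i | ∃ j ∈ A', j ∈ S i}
      have hsub : (Q ×ˢ Finset.univ).disjSum Finset.univ ⊆
          A.biUnion fun e : E => Finset.univ.filter fun i => s i e := by
        rintro (⟨i, t⟩ | t) hit
        · rw [Finset.inl_mem_disjSum, Finset.mem_product] at hit
          obtain ⟨j, hj, hji⟩ := (Finset.mem_filter.1 hit.1).2
          obtain ⟨e, he, rfl⟩ := Finset.mem_map.1 hj
          exact Finset.mem_biUnion.2 ⟨e, he, Finset.mem_filter.2 ⟨Finset.mem_univ _, hji⟩⟩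
        · exact Finset.mem_biUnion.2 ⟨e₀, he₀, Finset.mem_filter.2 ⟨Finset.mem_univ _, trivial⟩⟩
      refine le_trans ?_ (Finset.card_le_card hsub)
      rw [Finset.card_disjSum, Finset.card_product]
      simp only [Finset.card_univ, Fintype.card_fin]
      have hQ : Qᶜ.card + Q.card = m := by
        rw [Finset.card_compl_add_card, Fintype.card_fin]
      have hmul : Qᶜ.card * (δ - 1) + Q.card * (δ - 1) = m * (δ - 1) := by
        rw [← add_mul, hQ]
      -- If at least two local sets miss A, their large union bounds |A|; otherwise at most δ - 1
      -- rows are lost, and the bound on |E| suffices.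
      rcases le_or_gt 2 Qᶜ.card with h2 | h2
      · have h3 := hS Qᶜ h2
        have h4 : Disjoint A' (Qᶜ.biUnion S) := by
          refine Finset.disjoint_left.2 fun j hj hj' => ?_
          obtain ⟨i, hi, hji⟩ := Finset.mem_biUnion.1 hj'
          exact Finset.mem_compl.1 hi (Finset.mem_filter.2 ⟨Finset.mem_univ _, j, hj, hji⟩)
        have h5 := Finset.card_le_univ (A' ∪ Qᶜ.biUnion S)
        rw [Finset.card_union_of_disjoint h4, Fintype.card_fin] at h5
        omega
      · have : Qᶜ.card * (δ - 1) ≤ 1 * (δ - 1) := Nat.mul_le_mul_right _ (by omega)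
        omega
    have hzero := eq_zero_of_det_submatrix_ne_zero H v E f
      (hdet E f hf fun e => (Finset.mem_filter.1 (hfs e)).2) (fun e => hCH v hv _)
      (fun e j hj => by
        have : v j = 0 := by
          by_contra hvj
          exact hj (Finset.mem_filter.2 ⟨Finset.mem_univ _, hvj⟩)
        rw [this, mul_zero])
    refine hv0 (funext fun j => ?_)
    by_contra hj
    exact hj (hzero j (Finset.mem_filter.2 ⟨Finset.mem_univ _, hj⟩))

/-! ### The maximum distance -/

/-- Optimal LRCs with two "information" repair groups, in natural-number form. -/
theorem isDMax_of_two_groups {n k r δ a b m : ℕ} (hδ : 2 ≤ δ) (hr : r < k) (ha : k + a = 2 * r)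
    (hm : 1 ≤ m) (hn : n + b = (m + 1) * (r + δ - 1)) (hb : b ≤ m * a) :
    IsDMax n k r δ (n + 2 - k - δ) := by
  constructor
  · obtain ⟨S, hSr, hcov, hS⟩ := exists_covering n m a b (r + δ - 1) hn hb (by omega)
    obtain ⟨F, hF, hfin, C, hCk, hloc, hd⟩ := exists_code_of_covering (k := k) (r := r)
      (by omega) (by omega : 1 ≤ δ) S hSr hcov (fun P hP => by
        refine le_trans ?_ (hS P (Finset.card_pos.1 (by omega)))
        -- With |P| = c + 2, the required inequality holds with surplus c(r - a).
        obtain ⟨c, hc⟩ := Nat.exists_eq_add_of_le hP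
        rw [hc, show 2 + c - 1 = c + 1 by omega,
          show r + δ - 1 - a = (r - a) + (δ - 1) by omega]
        have : 0 ≤ c * (r - a) := Nat.zero_le _
        have h2 : r - a + a = r := by omega
        have h3 : δ - 1 + 1 = δ := by omega
        have h4 : k = r + (r - a) := by omega
        have h5 : r + δ - 1 = r + (δ - 1) := by omega
        rw [h4, h5]
        nlinarith)
    refine ⟨F, hF, hfin, C, hCk, hloc, le_antisymm ?_ hd⟩
    generalize hD : minDist (C : Set (Fin n → F)) = D at *
    induction D using ENat.recTopCoe with
    | top =>
      -- Infinite distance would allow any d; n + 3 already violates the bound.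
      have := minDist_add_le_of_hasAllSymbolLocality C (d := n + 3) (by omega) (by omega) hloc
        (by rw [hD]; exact le_top)
      omega
    | coe D =>
      have := minDist_add_le_of_hasAllSymbolLocality C (d := D) (by omega) (by omega) hloc
        hD.ge
      rw [Nat.cast_le]
      omega
  · rintro d ⟨F, hF, hfin, C, hCk, hloc, hd⟩
    have := minDist_add_le_of_hasAllSymbolLocality C (d := d) (by omega) (by omega) hloc hd.ge
    omega

theorem theorem4p1 (n k r δ : ℕ) (a b : ℤ)
    (ha : a = r * ⌈(k : ℚ) / r⌉ - k)
    (hb : b = ((r : ℤ) + δ - 1) * ⌈(n : ℚ) / ((r : ℚ) + δ - 1)⌉ - n)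
    (hr : 0 < r) (hrk : r < k)
    (hkn : (k : ℤ) ≤ n - ⌈(k : ℚ) / r⌉ * ((δ : ℤ) - 1))
    (hδ : 2 ≤ δ)
    (hk2 : ⌈(k : ℚ) / r⌉ = 2)
    (hab : a < b) (ha1 : ⌈(k : ℚ) / r⌉ - 1 ≤ a)
    (hm : ⌈(b : ℚ) / a⌉ + 1 ≤ ⌈(n : ℚ) / ((r : ℚ) + δ - 1)⌉) :
    ∃ d : ℕ, IsDMax n k r δ d ∧
      (d : ℤ) = n - k + 1 - (⌈(k : ℚ) / r⌉ - 1) * ((δ : ℤ) - 1) := by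
  rw [hk2] at ha hkn ha1 ⊢
  generalize ⌈(n : ℚ) / ((r : ℚ) + δ - 1)⌉ = M at *
  have ha0 : 0 < a := by omega
  have hbm : b ≤ (M - 1) * a := by
    have h1 : (b : ℚ) / a ≤ ((M - 1 : ℤ) : ℚ) := Int.ceil_le.1 (by omega)
    rw [div_le_iff₀ (by exact_mod_cast ha0)] at h1
    exact_mod_cast h1
  have hM : 2 ≤ M := by
    by_contra! h
    nlinarith
  obtain ⟨m, rfl⟩ : ∃ m : ℕ, M = m + 1 := ⟨(M - 1).toNat, by omega⟩
  lift a to ℕ using ha0.le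
  lift b to ℕ using by omega
  refine ⟨n + 2 - k - δ, isDMax_of_two_groups (a := a) (b := b) (m := m) hδ hrk
    (by omega) (by omega) ?_ ?_, by omega⟩
  · zify [show 1 ≤ r + δ by omega]
    linarith
  · rw [add_sub_cancel_right] at hbm
    exact_mod_cast hbm
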